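/- Let $\mathcal P=\{1,\dots,\mathrm N\}$ with $\mathrm N\ge 1$, let $f_p:\mathbb R^n\to\mathbb R^n$, $p\in\mathcal P$, be locally Lipschitz with $f_p(0)=0$, and let $\sigma=(\sigma(t))_{t\ge 0}$ be a càdlàg continuous-time Markov chain on $\mathcal P$, defined on a probability space $(\Omega,\mathfrak F,\mathsf P)$, with initial distribution $\pi^\circ$ and generator matrix $Q=[q_{ij}]$, where $q_{ij}\ge 0$ for $i\ne j$ and $\sum_{j\neq i}q_{ij}=-q_{ii}$. That is, for all $0=t_0\le t_1\le\dots\le t_m$ and $i_0,\dots,i_m\in\mathcal P$, $$\mathsf P(\sigma(t_0)=i_0,\dots,\sigma(t_m)=i_m)=\pi^\circ_{i_0}\prod_{k=0}^{m-1}\bigl(e^{(t_{k+1}-t_k)Q}\bigr)_{i_k i_{k+1}}.$$ Put $\overline q:=\max_{i}|q_{ii}|$ and $\widetilde q:=\max_{i,j}q_{ij}$. Consider the randomly switched system $$\dot x(t)=f_{\sigma(t)}(x(t)),\qquad x(0)=x_0,\qquad t\ge 0,$$ whose solutions are understood in the sense of Carathéodory, for each realization of $\sigma$. Suppose that there are continuously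 differentiable functions $V_p:\mathbb R^n\to[0,\infty)$, $p\in\mathcal P$, functions $\alpha_1,\alpha_2$ of class $\mathcal K_\infty$ (continuous strictly increasing functions $[0,\infty)\to[0,\infty)$ that vanish at $0$ and tend to $\infty$ at $\infty$), and real numbers $\lambda_\circ>0$, $\mu>1$ such that 1. $\alpha_1(\|x\|)\le V_p(x)\le\alpha_2(\|x\|)$ for all $x\in\mathbb R^n$, $p\in\mathcal P$; 2. $\frac{\partial V_p}{\partial x}(x)f_p(x)\le-\lambda_\circ V_p(x)$ for all $x\in\mathbb R^n$, $p\in\mathcal P$; 3. $V_{p_1}(x)\le\mu V_{p_2}(x)$ for all $x\in\mathbb R^n$, $p_1,p_2\in\mathcal P$; 4. $\mu<(\lambda_\circ+\widetilde q)/\overline q$ (no condition if $\overline q=0$). Then, almost surely, the system has exactly one solution $x(\cdot)$ on $[0,\infty)$ for every $x_0\in\mathbb R^n$, and the system is globally asymptotically stable almost surely, i.e. both of the following hold: - (SP1) almost surely, for every $\varepsilon>0$ there is $\delta>0$ such that for every $x_0$ with $\|x_0\|<\delta$, $\sup_{t\ge 0}\|x(t)\|<\varepsilon$; - (SP2) almost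 surely, for all $r,\varepsilon'>0$ there is $T\ge 0$ such that for every $x_0$ with $\|x_0\|<r$, $\sup_{t\ge T}\|x(t)\|<\varepsilon'$. -/

import Mathlib

open MeasureTheory Filter Topology
open scoped NNReal ENNReal

noncomputable section

namespace SwitchedSystem

/-- Class `𝒦∞`: continuous, strictly increasing, zero at zero and unbounded. -/
structure IsClassKInfty (α : ℝ≥0 → ℝ≥0) : Prop where
  continuous : Continuous α
  strictMono : StrictMono α
  map_zero : α 0 = 0
  tendsto_atTop : Tendsto α atTop atTop

/-- Generator matrices: nonnegative off-diagonal entries, and each diagonal entry is minus the sum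
of the off-diagonal entries of its row. -/
structure IsGenerator {N : ℕ} (Q : Matrix (Fin N) (Fin N) ℝ) : Prop where
  offDiag_nonneg : ∀ i j, i ≠ j → 0 ≤ Q i j
  row_sum : ∀ i, ∑ j ∈ Finset.univ.erase i, Q i j = -Q i i

/-- The transition matrix `P(t) = exp (t Q)`, that is, the unique solution of the Kolmogorov forward
equation `P'(t) = P(t) Q`, `P(0) = 1`. -/
def transition {N : ℕ} (Q : Matrix (Fin N) (Fin N) ℝ) (t : ℝ) : Matrix (Fin N) (Fin N) ℝ :=
  NormedSpace.exp (t • Q)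

/-- A path with values in a finite (discrete) set that is right-continuous with left limits. -/
structure IsCadlag {N : ℕ} (s : ℝ≥0 → Fin N) : Prop where
  right_continuous : ∀ t, ContinuousWithinAt s (Set.Ici t) t
  left_limit : ∀ t, 0 < t → ∃ l, Tendsto s (𝓝[<] t) (𝓝 l)

/-- `σ ∼ (π°, Q)`: the process `σ` is a càdlàg continuous-time Markov chain with initial
distribution `π₀` and generator matrix `Q`. Its law is given by the finite-dimensional
distributions `ℙ(σ(t₀) = i₀, …, σ(tₘ) = iₘ) = π₀(i₀) ∏ₖ P(tₖ₊₁ - tₖ)(iₖ, iₖ₊₁)`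
for `0 = t₀ ≤ t₁ ≤ … ≤ tₘ`. -/
structure IsMarkovChain {Ω : Type*} [MeasurableSpace Ω] (ℙ : Measure Ω) {N : ℕ}
    (σ : ℝ≥0 → Ω → Fin N) (π₀ : Fin N → ℝ) (Q : Matrix (Fin N) (Fin N) ℝ) : Prop where
  initial : π₀ ∈ stdSimplex ℝ (Fin N)
  generator : IsGenerator Q
  measurable : ∀ t, Measurable (σ t)
  cadlag : ∀ᵐ ω ∂ℙ, IsCadlag (fun t => σ t ω)
  finite_dim : ∀ (m : ℕ) (t : Fin (m + 1) → ℝ≥0), Monotone t → t 0 = 0 →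
    ∀ i : Fin (m + 1) → Fin N,
      ℙ {ω | ∀ k, σ (t k) ω = i k} =
        ENNReal.ofReal (π₀ (i 0) *
          ∏ k : Fin m, transition Q ((t k.succ : ℝ) - (t k.castSucc : ℝ)) (i k.castSucc) (i k.succ))

/-- `q̄`, the largest absolute value of a diagonal entry. -/
def qBar {N : ℕ} [NeZero N] (Q : Matrix (Fin N) (Fin N) ℝ) : ℝ :=
  Finset.univ.sup' Finset.univ_nonempty fun i : Fin N => |Q i i|

/-- `q̃`, the largest entry of the matrix. -/
def qTilde {N : ℕ} [NeZero N] (Q : Matrix (Fin N) (Fin N) ℝ) : ℝ :=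
  Finset.univ.sup' Finset.univ_nonempty fun ij : Fin N × Fin N => Q ij.1 ij.2

/-- `x` is a global Carathéodory solution on `[0, ∞)` of `ẋ(t) = f_{s(t)}(x(t))`, `x(0) = x₀`, in
integral form (equivalently: `x` is locally absolutely continuous, starts at `x₀` and satisfies the
differential equation at almost every time). -/
structure IsSolution {n N : ℕ}
    (f : Fin N → EuclideanSpace ℝ (Fin n) → EuclideanSpace ℝ (Fin n)) (s : ℝ≥0 → Fin N)
    (x₀ : EuclideanSpace ℝ (Fin n)) (x : ℝ≥0 → EuclideanSpace ℝ (Fin n)) : Prop where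
  continuous : Continuous x
  integrable : ∀ t : ℝ≥0,
    IntervalIntegrable (fun r : ℝ => f (s r.toNNReal) (x r.toNNReal)) volume 0 t
  integral_eq : ∀ t : ℝ≥0, x t = x₀ + ∫ r in (0 : ℝ)..t, f (s r.toNNReal) (x r.toNNReal)

/-- Global asymptotic stability almost surely of the randomly switched system `ẋ = f_σ(x)`: almost
every realization of `σ` has the two properties (SP1) and (SP2), where `x` runs over the solutions
for that realization from all initial states `x₀`. -/
structure GASAlmostSurely {Ω : Type*} [MeasurableSpace Ω] (ℙ : Measure Ω) {n N : ℕ}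
    (f : Fin N → EuclideanSpace ℝ (Fin n) → EuclideanSpace ℝ (Fin n))
    (σ : ℝ≥0 → Ω → Fin N) : Prop where
  sp1 : ∀ᵐ ω ∂ℙ, ∀ ε : ℝ, 0 < ε → ∃ δ : ℝ, 0 < δ ∧
    ∀ x₀ x, IsSolution f (fun t => σ t ω) x₀ x → ‖x₀‖ < δ →
      (⨆ t : ℝ≥0, ‖x t‖ₑ) < ENNReal.ofReal ε
  sp2 : ∀ᵐ ω ∂ℙ, ∀ r ε : ℝ, 0 < r → 0 < ε → ∃ T : ℝ≥0,
    ∀ x₀ x, IsSolution f (fun t => σ t ω) x₀ x → ‖x₀‖ < r →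
      (⨆ t : ℝ≥0, ⨆ _ : T ≤ t, ‖x t‖ₑ) < ENNReal.ofReal ε

end SwitchedSystem

end

open SwitchedSystem

/-!
The Lyapunov function of the active mode decays like `exp (-l₀ t)` between two jumps of `σ` and
grows at most by the factor `μ` at each jump, so it is bounded by `μ ^ J(t) * exp (-l₀ t)` times its
initial value, where `J(t)` is the number of jumps up to time `t`. Everything follows once this
factor is almost surely bounded and tends to zero (`exists_gain`).

The jumps are counted on the grids of mesh `h = 1 / (m + 1)`. On a grid of mesh `h` the expectation
of `μ ^ J` is a sum over paths of products of transition probabilities. As `Q + q̄` is entrywise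
nonnegative, `exp (h Q) = exp (-h q̄) exp (h (Q + q̄))` has diagonal entries at least `1 - q̄ h`, so
each step of the grid contributes at most `1 + (μ - 1) q̄ h`, whence `E[μ ^ J(k)] ≤ exp ((μ - 1) q̄ k)`
for every grid (`lintegral_gridWeight_le`). Since `q̃ ≤ q̄`, the assumption
`μ < (l₀ + q̃) / q̄` gives `(μ - 1) q̄ < l₀` (`jump_rate_lt`). Fatou's lemma along the grids and
summation over `k` then show that `μ ^ J(k) * exp (-l₀ k)` tends to zero almost surely
(`ae_exists_gridWeight_bound`).

A grid can miss jumps, but a càdlàg path with finitely many values has at most one jump in each cell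
of a sufficiently fine grid (`IsCadlag.exists_hasAtMostOneJump`), and then the counts on the grid do
control the growth of the Lyapunov functions (`DecaysAlong.le_gridWeight_mul`).

For a càdlàg mode signal a Carathéodory solution has a right derivative everywhere, which yields
uniqueness by Grönwall's inequality. For existence, the field is cut off outside a large ball; the
cut-off system has a global solution by a contraction argument in a weighted sup norm
(`exists_isSolution_of_lipschitzWith`), and the Lyapunov estimate shows that this solution never
reaches the boundary of the ball (`exists_isSolution_of_apriori`).
-/

namespace SwitchedSystem

/-! ### The transition matrices of a generator -/

section Transition

variable {N : ℕ} {Q : Matrix (Fin N) (Fin N) ℝ}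

attribute [local instance] Matrix.linftyOpNormedRing Matrix.linftyOpNormedAlgebra in
theorem hasSum_exp_matrix (A : Matrix (Fin N) (Fin N) ℝ) :
    HasSum (fun k : ℕ => ((k.factorial : ℝ)⁻¹) • A ^ k) (NormedSpace.exp A) :=
  NormedSpace.exp_series_hasSum_exp' (𝕂 := ℝ) A

theorem hasSum_exp_matrix_apply (A : Matrix (Fin N) (Fin N) ℝ) (i j : Fin N) :
    HasSum (fun k : ℕ => ((k.factorial : ℝ)⁻¹) * (A ^ k) i j) (NormedSpace.exp A i j) := by
  simpa using Pi.hasSum.1 (Pi.hasSum.1 (hasSum_exp_matrix A) i) j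

theorem pow_matrix_nonneg {B : Matrix (Fin N) (Fin N) ℝ} (hB : ∀ i j, 0 ≤ B i j) (k : ℕ) :
    ∀ i j, 0 ≤ (B ^ k) i j := by
  induction k with
  | zero =>
    intro i j
    rw [pow_zero, Matrix.one_apply]
    split_ifs <;> norm_num
  | succ k ih =>
    intro i j
    rw [pow_succ, Matrix.mul_apply]
    exact Finset.sum_nonneg fun l _ => mul_nonneg (ih i l) (hB l j)

theorem one_apply_le_exp {B : Matrix (Fin N) (Fin N) ℝ} (hB : ∀ i j, 0 ≤ B i j) (i j : Fin N) :
    (1 : Matrix (Fin N) (Fin N) ℝ) i j ≤ NormedSpace.exp B i j := by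
  have h := le_hasSum (hasSum_exp_matrix_apply B i j) 0
    fun k _ => mul_nonneg (by positivity) (pow_matrix_nonneg hB k i j)
  simpa using h

attribute [local instance] Matrix.linftyOpNormedRing Matrix.linftyOpNormedAlgebra in
theorem exp_smul_one_matrix (c : ℝ) :
    NormedSpace.exp (c • (1 : Matrix (Fin N) (Fin N) ℝ)) = Real.exp c • 1 := by
  rw [← Algebra.algebraMap_eq_smul_one, ← Algebra.algebraMap_eq_smul_one, Real.exp_eq_exp_ℝ,
    NormedSpace.algebraMap_exp_comm]
  rfl

/-- Uniformization: `exp (t Q) = exp (-t q) exp (t (Q + q))`, where `Q + q` is entrywise nonnegative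
as soon as `q` bounds the diagonal of `Q`. -/
theorem exp_neg_mul_one_apply_le_transition (hQ : IsGenerator Q) {q : ℝ} (hq : ∀ i, |Q i i| ≤ q)
    {t : ℝ} (ht : 0 ≤ t) (i j : Fin N) :
    Real.exp (-(t * q)) * (1 : Matrix (Fin N) (Fin N) ℝ) i j ≤ transition Q t i j := by
  have hsplit : t • Q = (-(t * q)) • (1 : Matrix (Fin N) (Fin N) ℝ) + t • (Q + q • 1) := by
    rw [smul_add, smul_smul, neg_smul]
    abel
  have hB : ∀ i j, 0 ≤ (t • (Q + q • (1 : Matrix (Fin N) (Fin N) ℝ))) i j := by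
    intro i j
    rw [Matrix.smul_apply, Matrix.add_apply, Matrix.smul_apply, smul_eq_mul, smul_eq_mul]
    refine mul_nonneg ht ?_
    by_cases hij : i = j
    · subst hij
      rw [Matrix.one_apply_eq]
      linarith [neg_abs_le (Q i i), hq i]
    · rw [Matrix.one_apply_ne hij]
      simpa using hQ.offDiag_nonneg i j hij
  rw [transition, hsplit, Matrix.exp_add_of_commute _ _ ((Commute.one_left _).smul_left _),
    exp_smul_one_matrix, smul_mul_assoc, one_mul, Matrix.smul_apply, smul_eq_mul]
  exact mul_le_mul_of_nonneg_left (one_apply_le_exp hB i j) (Real.exp_nonneg _)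

theorem transition_nonneg (hQ : IsGenerator Q) {t : ℝ} (ht : 0 ≤ t) (i j : Fin N) :
    0 ≤ transition Q t i j := by
  refine le_trans (mul_nonneg (Real.exp_nonneg _) ?_)
    (exp_neg_mul_one_apply_le_transition hQ (q := ∑ k, |Q k k|)
      (fun k => Finset.single_le_sum (f := fun k => |Q k k|) (fun _ _ => abs_nonneg _)
        (Finset.mem_univ k)) ht i j)
  rw [Matrix.one_apply]
  split_ifs <;> norm_num

theorem one_sub_le_transition_diag (hQ : IsGenerator Q) {q : ℝ} (hq : ∀ i, |Q i i| ≤ q)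
    {t : ℝ} (ht : 0 ≤ t) (i : Fin N) : 1 - t * q ≤ transition Q t i i := by
  have h := exp_neg_mul_one_apply_le_transition hQ hq ht i i
  rw [Matrix.one_apply_eq, mul_one] at h
  linarith [Real.add_one_le_exp (-(t * q))]

theorem transition_row_sum (hQ : IsGenerator Q) (t : ℝ) (i : Fin N) :
    ∑ j, transition Q t i j = 1 := by
  have hrow : ∀ i, ∑ j, (t • Q) i j = 0 := by
    intro i
    simp_rw [Matrix.smul_apply, ← Finset.smul_sum]
    rw [← Finset.add_sum_erase _ _ (Finset.mem_univ i), hQ.row_sum, add_neg_cancel, smul_zero]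
  have hpow : ∀ k : ℕ, k ≠ 0 → ∑ j, ((t • Q) ^ k) i j = 0 := by
    intro k hk
    obtain ⟨k, rfl⟩ := Nat.exists_eq_succ_of_ne_zero hk
    simp_rw [Nat.succ_eq_add_one, pow_succ, Matrix.mul_apply]
    rw [Finset.sum_comm]
    refine Finset.sum_eq_zero fun l _ => ?_
    rw [← Finset.mul_sum, hrow, mul_zero]
  have h := hasSum_sum fun j (_ : j ∈ Finset.univ) => hasSum_exp_matrix_apply (t • Q) i j
  refine h.unique ?_
  convert hasSum_single (0 : ℕ) ?_ using 1
  · simp [Matrix.one_apply]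
  · intro k hk
    rw [← Finset.mul_sum, hpow k hk, mul_zero]

end Transition

/-! ### The expected weight of the jumps on a grid -/

section Weight

/-- The factor by which the Lyapunov function can grow when the mode changes from `p` to `p'`. -/
def stepWeight {N : ℕ} (μ : ℝ) (p p' : Fin N) : ℝ := if p = p' then 1 else μ

/-- `μ` to the power of the number of indices `i < j` for which the values of the path `s` at the
grid points `i h` and `(i + 1) h` differ. -/
def gridWeight {N : ℕ} (μ : ℝ) (s : ℝ≥0 → Fin N) (h : ℝ≥0) (j : ℕ) : ℝ :=
  ∏ i ∈ Finset.range j, stepWeight μ (s (i * h)) (s ((i + 1 : ℕ) * h))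

theorem one_le_stepWeight {N : ℕ} {μ : ℝ} (hμ : 1 ≤ μ) (p p' : Fin N) :
    1 ≤ stepWeight μ p p' := by
  unfold stepWeight
  split_ifs <;> linarith

theorem stepWeight_le {N : ℕ} {μ : ℝ} (hμ : 1 ≤ μ) (p p' : Fin N) :
    stepWeight μ p p' ≤ μ := by
  unfold stepWeight
  split_ifs <;> linarith

theorem gridWeight_succ {N : ℕ} (μ : ℝ) (s : ℝ≥0 → Fin N) (h : ℝ≥0) (j : ℕ) :
    gridWeight μ s h (j + 1) =
      gridWeight μ s h j * stepWeight μ (s (j * h)) (s ((j + 1 : ℕ) * h)) :=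
  Finset.prod_range_succ _ _

theorem gridWeight_nonneg {N : ℕ} {μ : ℝ} (hμ : 1 ≤ μ) (s : ℝ≥0 → Fin N) (h : ℝ≥0) (j : ℕ) :
    0 ≤ gridWeight μ s h j :=
  Finset.prod_nonneg fun _ _ => zero_le_one.trans (one_le_stepWeight hμ _ _)

theorem gridWeight_mono {N : ℕ} {μ : ℝ} (hμ : 1 ≤ μ) (s : ℝ≥0 → Fin N) (h : ℝ≥0) :
    Monotone (gridWeight μ s h) := by
  refine monotone_nat_of_le_succ fun j => ?_
  rw [gridWeight_succ]
  exact le_mul_of_one_le_right (gridWeight_nonneg hμ s h j) (one_le_stepWeight hμ _ _)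

/-- If the rows of a nonnegative matrix sum to at most `ρ`, then the total weight of its paths of
length `j`, with initial weights `v`, is at most `ρ ^ j` times the total weight of `v`. -/
theorem sum_path_prod_le {N : ℕ} {M : Fin N → Fin N → ℝ} {ρ : ℝ} (hM : ∀ p p', 0 ≤ M p p')
    (hρ : ∀ p, ∑ p', M p p' ≤ ρ) (j : ℕ) (v : Fin N → ℝ) (hv : ∀ p, 0 ≤ v p) :
    ∑ i : Fin (j + 1) → Fin N, v (i 0) * ∏ k : Fin j, M (i k.castSucc) (i k.succ) ≤
      (∑ p, v p) * ρ ^ j := by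
  induction j generalizing v with
  | zero =>
    refine le_of_eq ?_
    rw [pow_zero, mul_one]
    refine Fintype.sum_equiv (Equiv.funUnique (Fin 1) (Fin N)) _ _ fun i => ?_
    simp
  | succ j ih =>
    -- Summing over the first vertex of the path replaces `v` by `v M`.
    have hstep : ∑ i : Fin (j + 1 + 1) → Fin N,
        v (i 0) * ∏ k : Fin (j + 1), M (i k.castSucc) (i k.succ) =
        ∑ i : Fin (j + 1) → Fin N,
          (∑ p, v p * M p (i 0)) * ∏ k : Fin j, M (i k.castSucc) (i k.succ) := by
      rw [← (Fin.consEquiv fun _ : Fin (j + 1 + 1) => Fin N).sum_comp, Fintype.sum_prod_type,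
        Finset.sum_comm]
      refine Finset.sum_congr rfl fun i _ => ?_
      rw [Finset.sum_mul]
      refine Finset.sum_congr rfl fun p _ => ?_
      rw [Fin.prod_univ_succ]
      simp [Fin.consEquiv, mul_assoc]
    rw [hstep]
    refine (ih (fun p' => ∑ p, v p * M p p')
      fun p' => Finset.sum_nonneg fun p _ => mul_nonneg (hv p) (hM p p')).trans ?_
    rcases isEmpty_or_nonempty (Fin N) with hN | ⟨⟨p₀⟩⟩
    · simp
    have hρ0 : 0 ≤ ρ := (Finset.sum_nonneg fun p' _ => hM p₀ p').trans (hρ p₀)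
    rw [pow_succ', ← mul_assoc]
    refine mul_le_mul_of_nonneg_right ?_ (pow_nonneg hρ0 j)
    rw [Finset.sum_comm, Finset.sum_mul]
    refine Finset.sum_le_sum fun p _ => ?_
    rw [← Finset.mul_sum]
    exact mul_le_mul_of_nonneg_left (hρ p) (hv p)

theorem sum_stepWeight_mul_transition_le {N : ℕ} {Q : Matrix (Fin N) (Fin N) ℝ}
    (hQ : IsGenerator Q) {μ q : ℝ} (hμ : 1 ≤ μ) (hq : ∀ i, |Q i i| ≤ q) {t : ℝ} (ht : 0 ≤ t)
    (p : Fin N) :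
    ∑ p', stepWeight μ p p' * transition Q t p p' ≤ Real.exp ((μ - 1) * q * t) := by
  have hdiag := one_sub_le_transition_diag hQ hq ht p
  have hsum := transition_row_sum hQ t p
  rw [← Finset.add_sum_erase _ _ (Finset.mem_univ p)] at hsum ⊢
  have hoff : ∑ p' ∈ Finset.univ.erase p, stepWeight μ p p' * transition Q t p p' =
      μ * ∑ p' ∈ Finset.univ.erase p, transition Q t p p' := by
    rw [Finset.mul_sum]
    refine Finset.sum_congr rfl fun p' hp' => ?_
    rw [stepWeight, if_neg (Finset.ne_of_mem_erase hp').symm]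
  rw [hoff, stepWeight, if_pos rfl, one_mul]
  refine le_trans ?_ (Real.add_one_le_exp _)
  nlinarith

theorem measurable_gridWeight {Ω : Type*} [MeasurableSpace Ω] {N : ℕ} {σ : ℝ≥0 → Ω → Fin N}
    (hσ : ∀ t, Measurable (σ t)) (μ : ℝ) (h : ℝ≥0) (j : ℕ) :
    Measurable fun ω => gridWeight μ (fun t => σ t ω) h j := by
  refine Finset.measurable_fun_prod _ fun i _ => ?_
  exact (measurable_of_finite fun pp : Fin N × Fin N => stepWeight μ pp.1 pp.2).comp
    ((hσ _).prodMk (hσ _))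

variable {Ω : Type*} [MeasurableSpace Ω] {ℙ : Measure Ω} {N : ℕ} {σ : ℝ≥0 → Ω → Fin N}
  {π₀ : Fin N → ℝ} {Q : Matrix (Fin N) (Fin N) ℝ}

/-- The bound depends on the time horizon `j h` only, and not on the mesh `h`. -/
theorem lintegral_gridWeight_le (hσ : IsMarkovChain ℙ σ π₀ Q) {μ q : ℝ} (hμ : 1 ≤ μ)
    (hq : ∀ i, |Q i i| ≤ q) (h : ℝ≥0) (j : ℕ) :
    ∫⁻ ω, ENNReal.ofReal (gridWeight μ (fun t => σ t ω) h j) ∂ℙ ≤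
      ENNReal.ofReal (Real.exp ((μ - 1) * q * (j * h))) := by
  have hw0 : ∀ p p' : Fin N, 0 ≤ stepWeight μ p p' := fun p p' =>
    zero_le_one.trans (one_le_stepWeight hμ p p')
  let Z : Ω → Fin (j + 1) → Fin N := fun ω k => σ ((k : ℕ) * h) ω
  have hZ : Measurable Z := measurable_pi_lambda _ fun k => hσ.measurable _
  let F : (Fin (j + 1) → Fin N) → ℝ≥0∞ := fun i =>
    ENNReal.ofReal (∏ k : Fin j, stepWeight μ (i k.castSucc) (i k.succ))
  have hF : Measurable F := measurable_of_finite F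
  have hstep : ∀ (i : Fin (j + 1) → Fin N), F i * ℙ (Z ⁻¹' {i}) = ENNReal.ofReal (π₀ (i 0) *
      ∏ k : Fin j, stepWeight μ (i k.castSucc) (i k.succ) *
        transition Q h (i k.castSucc) (i k.succ)) := by
    intro i
    have hset : Z ⁻¹' {i} = {ω | ∀ k : Fin (j + 1), σ ((k : ℕ) * h) ω = i k} := by
      ext ω
      simp [Z, funext_iff]
    have hfd := hσ.finite_dim j (fun k => (k : ℕ) * h)
      (fun a b hab => mul_le_mul_left (by exact_mod_cast hab) _) (by simp) i
    have hmesh : ∀ k : Fin j, (((((k.succ : Fin (j + 1)) : ℕ) : ℝ≥0) * h : ℝ≥0) : ℝ) -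
        ((((k.castSucc : Fin (j + 1)) : ℕ) : ℝ≥0) * h : ℝ≥0) = h := by
      intro k
      push_cast [Fin.val_succ, Fin.val_castSucc]
      ring
    simp_rw [hmesh] at hfd
    rw [hset, hfd, ← ENNReal.ofReal_mul (Finset.prod_nonneg fun k _ => hw0 _ _),
      Finset.prod_mul_distrib]
    congr 1
    ring
  have hterm : ∀ i : Fin (j + 1) → Fin N, 0 ≤ π₀ (i 0) *
      ∏ k : Fin j, stepWeight μ (i k.castSucc) (i k.succ) *
        transition Q h (i k.castSucc) (i k.succ) := fun i =>
    mul_nonneg (hσ.initial.1 _) (Finset.prod_nonneg fun k _ =>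
      mul_nonneg (hw0 _ _) (transition_nonneg hσ.generator h.coe_nonneg _ _))
  calc ∫⁻ ω, ENNReal.ofReal (gridWeight μ (fun t => σ t ω) h j) ∂ℙ
      = ∫⁻ ω, F (Z ω) ∂ℙ := by
        refine lintegral_congr fun ω => ?_
        simp only [F, Z, gridWeight, Finset.prod_range, Fin.val_succ, Fin.val_castSucc]
    _ = ∑ i, F i * ℙ (Z ⁻¹' {i}) := by
        rw [← lintegral_map hF hZ, lintegral_fintype]
        refine Finset.sum_congr rfl fun i _ => ?_
        rw [Measure.map_apply hZ (measurableSet_singleton i)]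
    _ = ENNReal.ofReal (∑ i : Fin (j + 1) → Fin N, π₀ (i 0) *
          ∏ k : Fin j, stepWeight μ (i k.castSucc) (i k.succ) *
            transition Q h (i k.castSucc) (i k.succ)) := by
        rw [ENNReal.ofReal_sum_of_nonneg fun i _ => hterm i]
        exact Finset.sum_congr rfl fun i _ => hstep i
    _ ≤ ENNReal.ofReal (Real.exp ((μ - 1) * q * (j * h))) := by
        refine ENNReal.ofReal_le_ofReal ?_
        refine (sum_path_prod_le (M := fun p p' => stepWeight μ p p' * transition Q h p p')
          (fun p p' => mul_nonneg (hw0 _ _) (transition_nonneg hσ.generator h.coe_nonneg _ _))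
          (sum_stepWeight_mul_transition_le hσ.generator hμ hq h.coe_nonneg) j π₀
          hσ.initial.1).trans ?_
        rw [hσ.initial.2, one_mul, ← Real.exp_nat_mul]
        exact le_of_eq (by ring_nf)

/-- The mesh `1 / (m + 1)`, for which every integer is a grid point. -/
noncomputable def mesh (m : ℕ) : ℝ≥0 := 1 / (m + 1)

theorem mul_succ_mul_mesh (k m : ℕ) : ((k * (m + 1) : ℕ) : ℝ) * mesh m = k := by
  rw [mesh]
  push_cast
  field_simp

/-- If the growth rate `(μ - 1) q` of the expected weight is less than `l₀`, then almost surely the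
weight of the jumps up to the integer time `k`, seen on suitable arbitrarily fine grids, is
negligible compared with `exp (l₀ k)`. This is Fatou's lemma on finer and finer grids, followed by
summation over `k`. -/
theorem ae_exists_gridWeight_bound (hσ : IsMarkovChain ℙ σ π₀ Q) {μ q l₀ : ℝ} (hμ : 1 ≤ μ)
    (hl₀ : 0 < l₀) (hq : ∀ i, |Q i i| ≤ q) (hrate : (μ - 1) * q < l₀) :
    ∀ᵐ ω ∂ℙ, ∃ a : ℕ → ℝ, Tendsto a atTop (𝓝 0) ∧ ∀ k : ℕ, ∃ᶠ m in atTop,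
      gridWeight μ (fun t => σ t ω) (mesh m) (k * (m + 1)) * Real.exp (-(l₀ * k)) ≤ a k := by
  let Y : ℕ → Ω → ℝ≥0∞ := fun k ω => liminf (fun m : ℕ =>
    ENNReal.ofReal (gridWeight μ (fun t => σ t ω) (mesh m) (k * (m + 1)))) atTop
  have hmeas : ∀ k m : ℕ, Measurable fun ω =>
      ENNReal.ofReal (gridWeight μ (fun t => σ t ω) (mesh m) (k * (m + 1))) := fun k m =>
    (measurable_gridWeight hσ.measurable μ _ _).ennreal_ofReal
  have hYmeas : ∀ k, Measurable (Y k) := fun k => Measurable.liminf fun m => hmeas k m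
  have hY : ∀ k, ∫⁻ ω, Y k ω ∂ℙ ≤ ENNReal.ofReal (Real.exp ((μ - 1) * q * k)) := by
    intro k
    refine (lintegral_liminf_le fun m => hmeas k m).trans ?_
    refine liminf_le_of_le (by isBoundedDefault) fun b hb => ?_
    obtain ⟨m, hm⟩ := hb.exists
    refine hm.trans ((lintegral_gridWeight_le hσ hμ hq _ _).trans (le_of_eq ?_))
    rw [mul_succ_mul_mesh]
  have hsum : ∫⁻ ω, ∑' k : ℕ, Y k ω * ENNReal.ofReal (Real.exp (-(l₀ * k))) ∂ℙ ≠ ⊤ := by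
    rw [lintegral_tsum fun k => ((hYmeas k).mul_const _).aemeasurable]
    refine ne_top_of_le_ne_top (b := ∑' k : ℕ, ENNReal.ofReal
      (Real.exp (((μ - 1) * q - l₀)) ^ k)) ?_ (ENNReal.tsum_le_tsum fun k => ?_)
    · have hs := summable_geometric_of_lt_one (Real.exp_nonneg ((μ - 1) * q - l₀))
        (Real.exp_lt_one_iff.2 (by linarith))
      rw [← ENNReal.ofReal_tsum_of_nonneg (fun k => by positivity) hs]
      exact ENNReal.ofReal_ne_top
    · rw [lintegral_mul_const _ (hYmeas k)]
      refine (mul_le_mul_left (hY k) _).trans (le_of_eq ?_)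
      rw [← ENNReal.ofReal_mul (Real.exp_nonneg _), ← Real.exp_add, ← Real.exp_nat_mul]
      ring_nf
  filter_upwards [ae_lt_top (Measurable.tsum fun k => (hYmeas k).mul_const _) hsum] with ω hω
  have hlim := ENNReal.tendsto_atTop_zero_of_tsum_ne_top hω.ne
  have hfin : ∀ k, Y k ω ≠ ⊤ := by
    intro k hk
    have h := (ENNReal.le_tsum (f := fun k : ℕ => Y k ω * ENNReal.ofReal (Real.exp (-(l₀ * k))))
      k).trans_lt hω
    rw [hk, ENNReal.top_mul (by simpa using Real.exp_pos _)] at h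
    exact lt_irrefl _ h
  refine ⟨fun k => ((Y k ω).toReal + 1) * Real.exp (-(l₀ * k)), ?_, fun k => ?_⟩
  · have h1 : Tendsto (fun k : ℕ => (Y k ω).toReal * Real.exp (-(l₀ * k))) atTop (𝓝 0) := by
      have h := (ENNReal.tendsto_toReal ENNReal.zero_ne_top).comp hlim
      simpa [Function.comp_def, ENNReal.toReal_mul, ENNReal.toReal_ofReal, Real.exp_nonneg] using h
    have h2 : Tendsto (fun k : ℕ => Real.exp (-(l₀ * k))) atTop (𝓝 0) :=
      Real.tendsto_exp_neg_atTop_nhds_zero.comp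
        (tendsto_natCast_atTop_atTop.const_mul_atTop hl₀)
    simpa [add_mul] using h1.add h2
  · have hlt : Y k ω < Y k ω + 1 := ENNReal.lt_add_right (hfin k) one_ne_zero
    refine (frequently_lt_of_liminf_lt (by isBoundedDefault) hlt).mono fun m hm => ?_
    refine mul_le_mul_of_nonneg_right ?_ (Real.exp_nonneg _)
    rw [← ENNReal.toReal_one, ← ENNReal.toReal_add (hfin k) ENNReal.one_ne_top]
    exact ENNReal.ofReal_le_iff_le_toReal
      (ENNReal.add_ne_top.2 ⟨hfin k, ENNReal.one_ne_top⟩) |>.1 hm.le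

/-- Every off-diagonal entry is at most the absolute value of the diagonal entry of its row, so
`qTilde Q ≤ qBar Q`. If `qBar Q = 0`, the claim is just `0 < l₀`. -/
theorem jump_rate_lt [NeZero N] (hQ : IsGenerator Q) {μ l₀ : ℝ} (hl₀ : 0 < l₀)
    (hrate : qBar Q ≠ 0 → μ < (l₀ + qTilde Q) / qBar Q) : (μ - 1) * qBar Q < l₀ := by
  have habs : ∀ i, |Q i i| ≤ qBar Q := fun i =>
    Finset.le_sup' (fun i => |Q i i|) (Finset.mem_univ i)
  have hle : qTilde Q ≤ qBar Q := by
    refine Finset.sup'_le _ _ fun ij _ => ?_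
    by_cases h : ij.1 = ij.2
    · rw [h]
      exact (le_abs_self _).trans (habs _)
    · refine le_trans ?_ (habs ij.1)
      refine le_trans ?_ (neg_le_abs (Q ij.1 ij.1))
      rw [← hQ.row_sum]
      exact Finset.single_le_sum (f := fun j => Q ij.1 j)
        (fun j hj => hQ.offDiag_nonneg _ _ (Finset.ne_of_mem_erase hj).symm)
        (Finset.mem_erase.2 ⟨fun e => h e.symm, Finset.mem_univ _⟩)
  have h0 : 0 ≤ qBar Q := (abs_nonneg _).trans (habs 0)
  rcases h0.eq_or_lt with h | h
  · rw [← h, mul_zero]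
    exact hl₀
  · have := (lt_div_iff₀ h).1 (hrate h.ne')
    linarith

end Weight

/-! ### The jumps of a càdlàg path on a fine grid -/

section Paths

/-- On `[a, b]` the path `S` takes at most two values, one before some time `τ` and one from `τ`
on. The time `τ` may lie outside `[a, b]`, in which case `S` is constant there. -/
def HasAtMostOneJump {N : ℕ} (S : ℝ → Fin N) (a b : ℝ) : Prop :=
  ∃ τ, (∀ t ∈ Set.Icc a b, ∀ u ∈ Set.Icc a b, t < τ → u < τ → S t = S u) ∧
    (∀ t ∈ Set.Icc a b, ∀ u ∈ Set.Icc a b, τ ≤ t → τ ≤ u → S t = S u)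

theorem HasAtMostOneJump.mono {N : ℕ} {S : ℝ → Fin N} {a b b' : ℝ} (h : HasAtMostOneJump S a b)
    (hb : b' ≤ b) : HasAtMostOneJump S a b' := by
  obtain ⟨τ, h1, h2⟩ := h
  have hsub : Set.Icc a b' ⊆ Set.Icc a b := Set.Icc_subset_Icc_right hb
  exact ⟨τ, fun t ht u hu => h1 t (hsub ht) u (hsub hu), fun t ht u hu => h2 t (hsub ht) u (hsub hu)⟩

variable {N : ℕ} {s : ℝ≥0 → Fin N}

theorem IsCadlag.eventually_eq_right (hs : IsCadlag s) (τ : ℝ) :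
    ∀ᶠ t in 𝓝[≥] τ, s t.toNNReal = s τ.toNNReal := by
  have h := hs.right_continuous τ.toNNReal
  rw [ContinuousWithinAt, nhds_discrete, tendsto_pure] at h
  refine Tendsto.eventually (tendsto_nhdsWithin_iff.2 ⟨?_, ?_⟩) h
  · exact continuous_real_toNNReal.continuousWithinAt
  · exact eventually_nhdsWithin_of_forall fun t ht => Real.toNNReal_le_toNNReal ht

theorem IsCadlag.exists_eventually_eq_left (hs : IsCadlag s) (τ : ℝ) :
    ∃ l, ∀ᶠ t in 𝓝[<] τ, s t.toNNReal = l := by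
  rcases le_or_gt τ 0 with hτ | hτ
  · refine ⟨s 0, eventually_nhdsWithin_of_forall fun t ht => ?_⟩
    rw [Real.toNNReal_of_nonpos (le_trans (le_of_lt ht) hτ)]
  · obtain ⟨l, hl⟩ := hs.left_limit τ.toNNReal (Real.toNNReal_pos.2 hτ)
    rw [nhds_discrete, tendsto_pure] at hl
    refine ⟨l, Tendsto.eventually (tendsto_nhdsWithin_iff.2 ⟨?_, ?_⟩) hl⟩
    · exact continuous_real_toNNReal.continuousWithinAt
    · exact eventually_nhdsWithin_of_forall fun t ht => (Real.toNNReal_lt_toNNReal_iff hτ).2 ht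

theorem IsCadlag.exists_ball (hs : IsCadlag s) (τ : ℝ) : ∃ ε > 0,
    (∀ t ∈ Metric.ball τ ε, ∀ u ∈ Metric.ball τ ε, t < τ → u < τ →
      s t.toNNReal = s u.toNNReal) ∧
    (∀ t ∈ Metric.ball τ ε, ∀ u ∈ Metric.ball τ ε, τ ≤ t → τ ≤ u →
      s t.toNNReal = s u.toNNReal) := by
  obtain ⟨l, hl⟩ := hs.exists_eventually_eq_left τ
  obtain ⟨ε₁, hε₁, h₁⟩ := Metric.mem_nhdsWithin_iff.1 hl
  obtain ⟨ε₂, hε₂, h₂⟩ := Metric.mem_nhdsWithin_iff.1 (hs.eventually_eq_right τ)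
  have hb₁ : Metric.ball τ (min ε₁ ε₂) ⊆ Metric.ball τ ε₁ := Metric.ball_subset_ball (min_le_left _ _)
  have hb₂ : Metric.ball τ (min ε₁ ε₂) ⊆ Metric.ball τ ε₂ :=
    Metric.ball_subset_ball (min_le_right _ _)
  refine ⟨min ε₁ ε₂, lt_min hε₁ hε₂, fun t ht u hu htτ huτ => ?_, fun t ht u hu htτ huτ => ?_⟩
  · exact (h₁ ⟨hb₁ ht, htτ⟩ : _ = l).trans (h₁ ⟨hb₁ hu, huτ⟩ : _ = l).symm
  · exact (h₂ ⟨hb₂ ht, htτ⟩ : _ = s τ.toNNReal).trans (h₂ ⟨hb₂ hu, huτ⟩ : _ = s τ.toNNReal).symm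

/-- A Lebesgue number argument: the jumps of a càdlàg path with values in a finite set are separated
on bounded intervals. -/
theorem IsCadlag.exists_hasAtMostOneJump (hs : IsCadlag s) (T : ℝ) : ∃ δ > 0, ∀ a ∈ Set.Icc 0 T,
    ∀ b, b - a < δ → HasAtMostOneJump (fun t => s t.toNNReal) a b := by
  choose ε hε h₁ h₂ using hs.exists_ball
  obtain ⟨δ, hδ, hcov⟩ := lebesgue_number_lemma_of_metric (isCompact_Icc (a := (0 : ℝ)) (b := T))
    (fun τ => Metric.isOpen_ball (x := τ) (ε := ε τ))
    (fun t _ => Set.mem_iUnion.2 ⟨t, Metric.mem_ball_self (hε t)⟩)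
  refine ⟨δ, hδ, fun a ha b hab => ?_⟩
  obtain ⟨τ, hτ⟩ := hcov a ha
  have hsub : Set.Icc a b ⊆ Metric.ball τ (ε τ) := by
    refine Set.Subset.trans (fun t ht => ?_) hτ
    rw [Metric.mem_ball, Real.dist_eq, abs_of_nonneg (by linarith [ht.1])]
    linarith [ht.2]
  exact ⟨τ, fun t ht u hu => h₁ τ t (hsub ht) u (hsub hu),
    fun t ht u hu => h₂ τ t (hsub ht) u (hsub hu)⟩

theorem tendsto_mesh : Tendsto (fun m => (mesh m : ℝ)) atTop (𝓝 0) := by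
  have h := tendsto_one_div_add_atTop_nhds_zero_nat (𝕜 := ℝ)
  refine h.congr fun m => ?_
  rw [mesh]
  push_cast
  rfl

theorem mesh_pos (m : ℕ) : 0 < (mesh m : ℝ) := by
  rw [mesh]
  push_cast
  positivity

/-! ### Multiple Lyapunov functions along a switched trajectory -/

variable {E : Type*} [NormedAddCommGroup E] [NormedSpace ℝ E]

/-- The trajectory `x` has right derivatives `x'` on `[a, b)`, along which the Lyapunov function of
the active mode `S t` decays at the exponential rate `c`. -/
structure DecaysAlong (V : Fin N → E → ℝ) (c : ℝ) (S : ℝ → Fin N) (x x' : ℝ → E) (a b : ℝ) :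
    Prop where
  continuousOn : ContinuousOn x (Set.Icc a b)
  hasDeriv : ∀ t ∈ Set.Ico a b, HasDerivWithinAt x (x' t) (Set.Ici t) t
  decay : ∀ t ∈ Set.Ico a b, fderiv ℝ (V (S t)) (x t) (x' t) ≤ -c * V (S t) (x t)

variable {V : Fin N → E → ℝ} {c : ℝ} {S : ℝ → Fin N} {x x' : ℝ → E} {a b : ℝ}

theorem DecaysAlong.mono (h : DecaysAlong V c S x x' a b) {a' b' : ℝ} (ha : a ≤ a')
    (hb : b' ≤ b) : DecaysAlong V c S x x' a' b' :=
  ⟨h.continuousOn.mono (Set.Icc_subset_Icc ha hb),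
    fun t ht => h.hasDeriv t (Set.Ico_subset_Ico ha hb ht),
    fun t ht => h.decay t (Set.Ico_subset_Ico ha hb ht)⟩

/-- The mode may change at the right endpoint `b`: only its values on `[a, b)` matter. -/
theorem DecaysAlong.le_of_mode_eq (hV : ∀ p, Differentiable ℝ (V p))
    (h : DecaysAlong V c S x x' a b) (hab : a ≤ b) {p : Fin N} (hp : ∀ t ∈ Set.Ico a b, S t = p) :
    V p (x b) ≤ Real.exp (-(c * (b - a))) * V p (x a) := by
  have hexp : ∀ t, HasDerivAt (fun t => Real.exp (c * (t - a))) (Real.exp (c * (t - a)) * c) t := by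
    intro t
    have h1 : HasDerivAt (fun t => c * (t - a)) c t := by
      simpa using ((hasDerivAt_id t).sub_const a).const_mul c
    exact h1.exp
  have key := image_le_of_deriv_right_le_deriv_boundary
    (f := fun t => Real.exp (c * (t - a)) * V p (x t))
    (f' := fun t => Real.exp (c * (t - a)) * c * V p (x t) +
      Real.exp (c * (t - a)) * fderiv ℝ (V p) (x t) (x' t))
    (a := a) (b := b) (B := fun _ => V p (x a)) (B' := fun _ => 0) ?_ ?_ ?_ continuousOn_const
    (fun t _ => hasDerivWithinAt_const _ _ _) ?_ (Set.right_mem_Icc.2 hab)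
  · have hpos := Real.exp_pos (c * (b - a))
    rw [Real.exp_neg, ← div_eq_inv_mul, le_div_iff₀ hpos, mul_comm]
    exact key
  · exact (continuous_iff_continuousAt.2 fun t => (hexp t).continuousAt).continuousOn.mul
      ((hV p).continuous.comp_continuousOn h.continuousOn)
  · intro t ht
    exact (hexp t).hasDerivWithinAt.mul
      (((hV p) (x t)).hasFDerivAt.comp_hasDerivWithinAt t (h.hasDeriv t ht))
  · simp
  · intro t ht
    have hd := h.decay t ht
    rw [hp t ht] at hd
    have hpos := Real.exp_pos (c * (t - a))
    nlinarith

theorem DecaysAlong.le_of_hasAtMostOneJump (hV : ∀ p, Differentiable ℝ (V p)) {μ : ℝ}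
    (hμ : 1 ≤ μ) (hratio : ∀ p p' y, V p y ≤ μ * V p' y) (h : DecaysAlong V c S x x' a b) (hab : a ≤ b)
    (hS : HasAtMostOneJump S a b) :
    V (S b) (x b) ≤
      stepWeight μ (S a) (S b) * (Real.exp (-(c * (b - a))) * V (S a) (x a)) := by
  have hstep : ∀ p p' y, V p' y ≤ stepWeight μ p p' * V p y := by
    intro p p' y
    rw [stepWeight]
    split_ifs with hpp
    · rw [hpp, one_mul]
    · exact hratio p' p y
  have hconst : (∀ t ∈ Set.Icc a b, S t = S a) → V (S b) (x b) ≤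
      stepWeight μ (S a) (S b) * (Real.exp (-(c * (b - a))) * V (S a) (x a)) := by
    intro hc
    have hb := hc b (Set.right_mem_Icc.2 hab)
    rw [stepWeight, if_pos hb.symm, one_mul, hb]
    exact h.le_of_mode_eq hV hab fun t ht => hc t (Set.Ico_subset_Icc_self ht)
  have hamem := Set.left_mem_Icc.2 hab
  have hbmem := Set.right_mem_Icc.2 hab
  obtain ⟨τ, h1, h2⟩ := hS
  rcases le_or_gt τ a with hτa | haτ
  · exact hconst fun t ht => h2 t ht a hamem (hτa.trans ht.1) hτa
  rcases lt_or_ge b τ with hbτ | hτb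
  · exact hconst fun t ht => h1 t ht a hamem (ht.2.trans_lt hbτ) haτ
  have hleft := (h.mono le_rfl hτb).le_of_mode_eq hV haτ.le (p := S a) fun t ht =>
    h1 t ⟨ht.1, ht.2.le.trans hτb⟩ a hamem ht.2 haτ
  have hright := (h.mono haτ.le le_rfl).le_of_mode_eq hV hτb (p := S b) fun t ht =>
    h2 t ⟨haτ.le.trans ht.1, ht.2.le⟩ b hbmem ht.1 hτb
  have hw : 0 ≤ stepWeight μ (S a) (S b) := zero_le_one.trans (one_le_stepWeight hμ _ _)
  calc V (S b) (x b) ≤ Real.exp (-(c * (b - τ))) * V (S b) (x τ) := hright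
    _ ≤ Real.exp (-(c * (b - τ))) * (stepWeight μ (S a) (S b) * V (S a) (x τ)) := by
        gcongr
        exact hstep _ _ _
    _ ≤ Real.exp (-(c * (b - τ))) * (stepWeight μ (S a) (S b) *
          (Real.exp (-(c * (τ - a))) * V (S a) (x a))) := by gcongr
    _ = _ := by
        have hexp : Real.exp (-(c * (b - a))) =
            Real.exp (-(c * (b - τ))) * Real.exp (-(c * (τ - a))) := by
          rw [← Real.exp_add]
          ring_nf
        rw [hexp]
        ring

/-- The weights of a fine grid control the growth of the Lyapunov function up to any time `T ≤ k`; the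
additional factor `μ` accounts for a jump between the last grid point before `T` and `T` itself. -/
theorem DecaysAlong.le_gridWeight_mul (hV : ∀ p, Differentiable ℝ (V p))
    (hV0 : ∀ p y, 0 ≤ V p y) {μ : ℝ} (hμ : 1 ≤ μ) (hratio : ∀ p p' y, V p y ≤ μ * V p' y)
    (hs : IsCadlag s) (k : ℕ) : ∀ᶠ m in atTop, ∀ T ∈ Set.Icc (0 : ℝ) k, ∀ x x' : ℝ → E,
      DecaysAlong V c (fun t => s t.toNNReal) x x' 0 T →
      V (s T.toNNReal) (x T) ≤
        μ * gridWeight μ s (mesh m) (k * (m + 1)) * (Real.exp (-(c * T)) * V (s 0) (x 0)) := by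
  obtain ⟨δ, hδ, hjump⟩ := hs.exists_hasAtMostOneJump k
  filter_upwards [tendsto_mesh.eventually (gt_mem_nhds hδ)] with m hm T hT x x' hx
  set h : ℝ≥0 := mesh m with hh
  have hpos : 0 < (h : ℝ) := mesh_pos m
  have hgrid : ∀ j : ℕ, (j : ℝ) * h ≤ T → V (s (j * h)) (x (j * h)) ≤
      gridWeight μ s h j * (Real.exp (-(c * (j * h))) * V (s 0) (x 0)) := by
    intro j
    induction j with
    | zero => simp [gridWeight]
    | succ j ih =>
      intro hj
      have hstep : ((j : ℝ) * h) ≤ ((j + 1 : ℕ) : ℝ) * h := by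
        push_cast
        nlinarith
      have hj0 : (0 : ℝ) ≤ j * h := by positivity
      have hdiff : ((j + 1 : ℕ) : ℝ) * h - j * h = h := by
        push_cast
        ring
      have h1 := ih (hstep.trans hj)
      have h2 := (hx.mono hj0 hj).le_of_hasAtMostOneJump hV hμ hratio hstep
        (hjump _ ⟨hj0, (hstep.trans hj).trans hT.2⟩ _ (by rw [hdiff]; exact hm))
      have hcast : ∀ i : ℕ, ((i : ℝ) * h).toNNReal = i * h := fun i => by
        rw [← NNReal.coe_natCast, ← NNReal.coe_mul, Real.toNNReal_coe]
      simp only [hcast, hdiff] at h2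
      rw [gridWeight_succ]
      have hw : 0 ≤ stepWeight μ (s (j * h)) (s ((j + 1 : ℕ) * h)) :=
        zero_le_one.trans (one_le_stepWeight hμ _ _)
      refine h2.trans ((mul_le_mul_of_nonneg_left
        (mul_le_mul_of_nonneg_left h1 (Real.exp_nonneg _)) hw).trans (le_of_eq ?_))
      have hexp : Real.exp (-(c * ((j + 1 : ℕ) * h))) =
          Real.exp (-(c * h)) * Real.exp (-(c * (j * h))) := by
        rw [← Real.exp_add]
        push_cast
        ring_nf
      rw [hexp]
      ring
  -- The last grid point before `T`.
  set j : ℕ := ⌊T / h⌋₊ with hjdef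
  have hjT : (j : ℝ) * h ≤ T := (le_div_iff₀ hpos).1 (Nat.floor_le (div_nonneg hT.1 hpos.le))
  have hTj : T < (j + 1) * h := (div_lt_iff₀ hpos).1 (Nat.lt_floor_add_one _)
  have hj0 : (0 : ℝ) ≤ j * h := by positivity
  have hjk : j ≤ k * (m + 1) := by
    have h3 : (j : ℝ) * h ≤ ((k * (m + 1) : ℕ) : ℝ) * h := by
      rw [mul_succ_mul_mesh]
      exact hjT.trans hT.2
    exact_mod_cast le_of_mul_le_mul_right h3 hpos
  have h1 := hgrid j hjT
  have h2 := (hx.mono hj0 le_rfl).le_of_hasAtMostOneJump hV hμ hratio hjT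
    (hjump _ ⟨hj0, hjT.trans hT.2⟩ _ (by linarith))
  have hcast : ((j : ℝ) * h).toNNReal = j * h := by
    rw [← NNReal.coe_natCast, ← NNReal.coe_mul, Real.toNNReal_coe]
  simp only [hcast] at h2
  have hexp : Real.exp (-(c * T)) = Real.exp (-(c * (T - j * h))) * Real.exp (-(c * (j * h))) := by
    rw [← Real.exp_add]
    ring_nf
  have hμ0 : 0 ≤ μ := zero_le_one.trans hμ
  calc V (s T.toNNReal) (x T)
      ≤ μ * (Real.exp (-(c * (T - j * h))) * V (s (j * h)) (x (j * h))) :=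
        h2.trans (mul_le_mul_of_nonneg_right (stepWeight_le hμ _ _)
          (mul_nonneg (Real.exp_nonneg _) (hV0 _ _)))
    _ ≤ μ * (Real.exp (-(c * (T - j * h))) *
          (gridWeight μ s h j * (Real.exp (-(c * (j * h))) * V (s 0) (x 0)))) := by gcongr
    _ = μ * gridWeight μ s h j * (Real.exp (-(c * T)) * V (s 0) (x 0)) := by
        rw [hexp]
        ring
    _ ≤ _ := by
        refine mul_le_mul_of_nonneg_right
          (mul_le_mul_of_nonneg_left (gridWeight_mono hμ s h hjk) hμ0)
          (mul_nonneg (Real.exp_nonneg _) (hV0 _ _))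

/-- Along a path whose jump weight is eventually beaten by the decay, the Lyapunov function of the
active mode is controlled by a bounded gain that tends to zero and depends on the path only. -/
theorem exists_gain (hV : ∀ p, Differentiable ℝ (V p)) (hV0 : ∀ p y, 0 ≤ V p y) {μ : ℝ}
    (hμ : 1 ≤ μ) (hratio : ∀ p p' y, V p y ≤ μ * V p' y) (hs : IsCadlag s) (hc : 0 ≤ c)
    {a : ℕ → ℝ} (ha : Tendsto a atTop (𝓝 0))
    (hfreq : ∀ k : ℕ, ∃ᶠ m in atTop,
      gridWeight μ s (mesh m) (k * (m + 1)) * Real.exp (-(c * k)) ≤ a k) :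
    ∃ g : ℝ → ℝ, Tendsto g atTop (𝓝 0) ∧ (∃ C, ∀ T, g T ≤ C) ∧
      ∀ T, 0 ≤ T → ∀ x x' : ℝ → E, DecaysAlong V c (fun t => s t.toNNReal) x x' 0 T →
        V (s T.toNNReal) (x T) ≤ g T * V (s 0) (x 0) := by
  have hμ0 : 0 ≤ μ := zero_le_one.trans hμ
  refine ⟨fun T => μ * Real.exp c * a (⌊T⌋₊ + 1), ?_, ?_, ?_⟩
  · have h := (ha.comp ((tendsto_add_atTop_nat 1).comp
      (tendsto_nat_floor_atTop (α := ℝ)))).const_mul (μ * Real.exp c)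
    rwa [mul_zero] at h
  · obtain ⟨C, hC⟩ := ha.bddAbove_range
    exact ⟨μ * Real.exp c * C, fun T => mul_le_mul_of_nonneg_left (hC ⟨_, rfl⟩)
      (mul_nonneg hμ0 (Real.exp_nonneg _))⟩
  · intro T hT x x' hx
    obtain ⟨m, hm, hbound⟩ :=
      ((hfreq (⌊T⌋₊ + 1)).and_eventually
        (DecaysAlong.le_gridWeight_mul (c := c) hV hV0 hμ hratio hs (⌊T⌋₊ + 1))).exists
    have hTk : T ≤ ((⌊T⌋₊ + 1 : ℕ) : ℝ) := by
      push_cast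
      exact (Nat.lt_floor_add_one T).le
    have hkT : ((⌊T⌋₊ + 1 : ℕ) : ℝ) ≤ T + 1 := by
      push_cast
      linarith [Nat.floor_le hT]
    refine (hbound T ⟨hT, hTk⟩ x x' hx).trans ?_
    beta_reduce
    generalize hk : ⌊T⌋₊ + 1 = k at *
    have hW := gridWeight_nonneg hμ s (mesh m) (k * (m + 1))
    have hexp : Real.exp (-(c * T)) ≤ Real.exp c * Real.exp (-(c * k)) := by
      rw [← Real.exp_add]
      refine Real.exp_le_exp.2 ?_
      nlinarith
    calc μ * gridWeight μ s (mesh m) (k * (m + 1)) * (Real.exp (-(c * T)) * V (s 0) (x 0))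
        = μ * (gridWeight μ s (mesh m) (k * (m + 1)) * Real.exp (-(c * T))) * V (s 0) (x 0) := by
          ring
      _ ≤ μ * (gridWeight μ s (mesh m) (k * (m + 1)) * (Real.exp c * Real.exp (-(c * k)))) *
            V (s 0) (x 0) := by
          refine mul_le_mul_of_nonneg_right ?_ (hV0 _ _)
          gcongr
      _ = μ * Real.exp c * (gridWeight μ s (mesh m) (k * (m + 1)) * Real.exp (-(c * k))) *
            V (s 0) (x 0) := by
          ring
      _ ≤ μ * Real.exp c * a k * V (s 0) (x 0) := by
          refine mul_le_mul_of_nonneg_right ?_ (hV0 _ _)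
          gcongr

end Paths

/-! ### Carathéodory solutions for a càdlàg mode signal -/

section Solutions

variable {n N : ℕ} {s : ℝ≥0 → Fin N}

/-- A right-continuous path with values in a finite set is the pointwise limit of step functions. -/
theorem IsCadlag.measurable (hs : IsCadlag s) : Measurable s := by
  have hmesh : ∀ m, mesh m ≠ 0 := fun m => by simpa using (mesh_pos m).ne'
  refine measurable_of_tendsto_metrizable
    (f := fun m t => s ((⌈t / mesh m⌉₊ : ℝ≥0) * mesh m)) (fun m => ?_) ?_
  · exact (measurable_of_countable fun k : ℕ => s ((k : ℝ≥0) * mesh m)).comp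
      (Nat.measurable_ceil.comp (measurable_id.div_const _))
  · rw [tendsto_pi_nhds]
    intro t
    refine (hs.right_continuous t).tendsto.comp (tendsto_nhdsWithin_iff.2 ⟨?_, ?_⟩)
    · have hle : ∀ m, t ≤ (⌈t / mesh m⌉₊ : ℝ≥0) * mesh m := fun m =>
        (div_le_iff₀ (pos_iff_ne_zero.2 (hmesh m))).1 (Nat.le_ceil _)
      have hge : ∀ m, (⌈t / mesh m⌉₊ : ℝ≥0) * mesh m ≤ t + mesh m := fun m => by
        have h := mul_le_mul_left (Nat.ceil_lt_add_one (zero_le (a := t / mesh m))).le (mesh m)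
        rwa [add_mul, one_mul, div_mul_cancel₀ _ (hmesh m)] at h
      have hlim : Tendsto (fun m => t + mesh m) atTop (𝓝 t) := by
        have h0 : Tendsto mesh atTop (𝓝 0) := NNReal.tendsto_coe.1 tendsto_mesh
        simpa using tendsto_const_nhds.add h0
      exact tendsto_of_tendsto_of_tendsto_of_le_of_le tendsto_const_nhds hlim hle hge
    · exact Eventually.of_forall fun m =>
        (div_le_iff₀ (pos_iff_ne_zero.2 (hmesh m))).1 (Nat.le_ceil _)

variable {f : Fin N → EuclideanSpace ℝ (Fin n) → EuclideanSpace ℝ (Fin n)}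
  {x₀ : EuclideanSpace ℝ (Fin n)} {x : ℝ≥0 → EuclideanSpace ℝ (Fin n)}

theorem measurable_switched_field (hf : ∀ p, Continuous (f p)) (hs : IsCadlag s)
    (hx : Continuous x) :
    Measurable fun r : ℝ => f (s r.toNNReal) (x r.toNNReal) := by
  have h : Measurable fun py : Fin N × EuclideanSpace ℝ (Fin n) => f py.1 py.2 :=
    measurable_from_prod_countable_right fun p => (hf p).measurable
  exact h.comp ((hs.measurable.comp measurable_real_toNNReal).prodMk
    (hx.measurable.comp measurable_real_toNNReal))

theorem IsSolution.apply_zero (hx : IsSolution f s x₀ x) : x 0 = x₀ := by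
  simpa using hx.integral_eq 0

theorem IsSolution.continuous_toNNReal (hx : IsSolution f s x₀ x) :
    Continuous fun r : ℝ => x r.toNNReal :=
  hx.continuous.comp continuous_real_toNNReal

/-- As the mode signal is right-continuous, the differential equation holds for the right derivative
at every time, and not just at almost every time. -/
theorem IsSolution.hasDerivWithinAt (hf : ∀ p, Continuous (f p)) (hs : IsCadlag s)
    (hx : IsSolution f s x₀ x) {t : ℝ} (ht : 0 ≤ t) :
    HasDerivWithinAt (fun r : ℝ => x r.toNNReal) (f (s t.toNNReal) (x t.toNNReal)) (Set.Ici t) t := by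
  have hcont : ContinuousWithinAt (fun r : ℝ => f (s r.toNNReal) (x r.toNNReal)) (Set.Ici t) t := by
    have h : ContinuousWithinAt (fun r : ℝ => f (s t.toNNReal) (x r.toNNReal)) (Set.Ici t) t :=
      ((hf _).comp hx.continuous_toNNReal).continuousWithinAt
    exact h.congr_of_eventuallyEq
      ((hs.eventually_eq_right t).mono fun r hr => by simp only [hr]) rfl
  have hint := hx.integrable t.toNNReal
  rw [Real.coe_toNNReal t ht] at hint
  have h := intervalIntegral.integral_hasDerivWithinAt_right hint (s := Set.Ici t) (t := Set.Ioi t)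
    ((measurable_switched_field hf hs hx.continuous).stronglyMeasurable.stronglyMeasurableAtFilter)
    (hcont.mono Set.Ioi_subset_Ici_self)
  refine (h.const_add x₀).congr_of_eventuallyEq
    (eventually_nhdsWithin_of_forall fun r hr => ?_) ?_
  · have h' := hx.integral_eq r.toNNReal
    rwa [Real.coe_toNNReal r (ht.trans hr)] at h'
  · have h' := hx.integral_eq t.toNNReal
    rwa [Real.coe_toNNReal t ht] at h'

theorem exists_lipschitzOnWith_closedBall (hf : ∀ p, LocallyLipschitz (f p)) (R : ℝ) :
    ∃ K : ℝ≥0, ∀ p, LipschitzOnWith K (f p) (Metric.closedBall 0 R) := by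
  have h : ∀ p, ∃ K : ℝ≥0, LipschitzOnWith K (f p) (Metric.closedBall 0 R) := fun p =>
    (hf p).locallyLipschitzOn.exists_lipschitzOnWith_of_compact (isCompact_closedBall 0 R)
  choose K hK using h
  exact ⟨∑ p, K p, fun p => (hK p).weaken
    (Finset.single_le_sum (fun _ _ => zero_le) (Finset.mem_univ p))⟩

theorem IsSolution.unique (hf : ∀ p, LocallyLipschitz (f p)) (hs : IsCadlag s)
    {y : ℝ≥0 → EuclideanSpace ℝ (Fin n)} (hx : IsSolution f s x₀ x) (hy : IsSolution f s x₀ y) :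
    x = y := by
  funext T
  have hb : ∀ z : ℝ≥0 → EuclideanSpace ℝ (Fin n), IsSolution f s x₀ z →
      ∃ R, ∀ t ∈ Set.Icc (0 : ℝ) T, ‖z t.toNNReal‖ ≤ R := fun z hz =>
    isCompact_Icc.exists_bound_of_continuousOn hz.continuous_toNNReal.continuousOn
  obtain ⟨R₁, h₁⟩ := hb x hx
  obtain ⟨R₂, h₂⟩ := hb y hy
  obtain ⟨K, hK⟩ := exists_lipschitzOnWith_closedBall hf (max R₁ R₂)
  have h := ODE_solution_unique_of_mem_Icc_right (a := 0) (b := T) (K := K)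
    (v := fun t => f (s t.toNNReal)) (s := fun _ => Metric.closedBall 0 (max R₁ R₂))
    (fun t _ => hK _) hx.continuous_toNNReal.continuousOn
    (fun t ht => hx.hasDerivWithinAt (fun p => (hf p).continuous) hs ht.1)
    (fun t ht => mem_closedBall_zero_iff.2
      ((h₁ t (Set.Ico_subset_Icc_self ht)).trans (le_max_left _ _)))
    hy.continuous_toNNReal.continuousOn
    (fun t ht => hy.hasDerivWithinAt (fun p => (hf p).continuous) hs ht.1)
    (fun t ht => mem_closedBall_zero_iff.2
      ((h₂ t (Set.Ico_subset_Icc_self ht)).trans (le_max_right _ _)))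
    (by simp [hx.apply_zero, hy.apply_zero])
  simpa using h (Set.right_mem_Icc.2 T.coe_nonneg)

end Solutions

/-! ### Existence of solutions for bounded Lipschitz fields -/

section Existence

variable {n N : ℕ} {s : ℝ≥0 → Fin N}
  {g : Fin N → EuclideanSpace ℝ (Fin n) → EuclideanSpace ℝ (Fin n)}

open BoundedContinuousFunction in
/-- Picard's integral operator, conjugated by `exp (L t)`, is a contraction of the bounded
continuous functions on the whole half-line as soon as `L` exceeds the Lipschitz constant. -/
theorem exists_isSolution_of_lipschitzWith (hs : IsCadlag s) {K : ℝ≥0} {B : ℝ}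
    (hg : ∀ p, LipschitzWith K (g p)) (hB : ∀ p y, ‖g p y‖ ≤ B) (x₀ : EuclideanSpace ℝ (Fin n)) :
    ∃ x, IsSolution g s x₀ x := by
  set L : ℝ := 2 * K + 1 with hL
  have hLpos : 0 < L := by positivity
  have hL1 : 1 ≤ L := by
    rw [hL]
    linarith [K.coe_nonneg]
  have hB0 : 0 ≤ B := (norm_nonneg _).trans (hB (s 0) 0)
  -- A function `y` of the weighted space stands for the trajectory `exp (L t) y(t)`.
  let X : (ℝ≥0 →ᵇ EuclideanSpace ℝ (Fin n)) → ℝ≥0 → EuclideanSpace ℝ (Fin n) :=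
    fun y t => Real.exp (L * t) • y t
  have hX : ∀ y, Continuous (X y) := fun y => by
    have := y.continuous
    fun_prop
  let F : (ℝ≥0 →ᵇ EuclideanSpace ℝ (Fin n)) → ℝ → EuclideanSpace ℝ (Fin n) :=
    fun y r => g (s r.toNNReal) (X y r.toNNReal)
  have hF : ∀ y (a b : ℝ), IntervalIntegrable (F y) volume a b := fun y a b => by
    have hm := measurable_switched_field (fun p => (hg p).continuous) hs (hX y)
    exact (intervalIntegrable_const (c := B)).mono_fun hm.aestronglyMeasurable
      (Eventually.of_forall fun r => (hB _ _).trans (le_abs_self B))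
  let I : (ℝ≥0 →ᵇ EuclideanSpace ℝ (Fin n)) → ℝ≥0 → EuclideanSpace ℝ (Fin n) :=
    fun y t => x₀ + ∫ r in (0 : ℝ)..t, F y r
  have hI : ∀ y, Continuous (I y) := fun y =>
    continuous_const.add ((intervalIntegral.continuous_primitive (hF y) 0).comp
      NNReal.continuous_coe)
  have hIbound : ∀ y t, ‖I y t‖ ≤ ‖x₀‖ + B * t := fun y t => by
    refine (norm_add_le _ _).trans (add_le_add_right ?_ _)
    have h := intervalIntegral.norm_integral_le_of_norm_le_const (a := (0 : ℝ)) (b := t)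
      (f := F y) (C := B) fun r _ => hB _ _
    rwa [sub_zero, abs_of_nonneg t.coe_nonneg] at h
  let Φ : (ℝ≥0 →ᵇ EuclideanSpace ℝ (Fin n)) → (ℝ≥0 →ᵇ EuclideanSpace ℝ (Fin n)) := fun y =>
    ofNormedAddCommGroup (fun t => Real.exp (-(L * t)) • I y t)
      (by have := hI y; fun_prop) (‖x₀‖ + B) (by
        intro t
        rw [norm_smul, Real.norm_eq_abs, abs_of_pos (Real.exp_pos _), Real.exp_neg,
          ← div_eq_inv_mul, div_le_iff₀ (Real.exp_pos _)]
        have hexp : (t : ℝ) + 1 ≤ Real.exp (L * t) :=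
          le_trans (by nlinarith [t.coe_nonneg]) (Real.add_one_le_exp _)
        refine (hIbound y t).trans ?_
        nlinarith [t.coe_nonneg, norm_nonneg x₀])
  have hexpint : ∀ t : ℝ≥0, ∫ r in (0 : ℝ)..t, Real.exp (L * r) = (Real.exp (L * t) - 1) / L := by
    intro t
    have h := intervalIntegral.integral_eq_sub_of_hasDerivAt (a := (0 : ℝ)) (b := t)
      (f := fun r => Real.exp (L * r) / L) (f' := fun r => Real.exp (L * r)) (fun r _ => ?_)
      (Continuous.intervalIntegrable (by fun_prop) _ _)
    · rw [h, mul_zero, Real.exp_zero]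
      ring
    · have h1 : HasDerivAt (fun r => L * r) L r := by simpa using (hasDerivAt_id r).const_mul L
      have h2 := h1.exp.div_const L
      rwa [mul_div_cancel_right₀ _ hLpos.ne'] at h2
  have hdist : ∀ y z, dist (Φ y) (Φ z) ≤ ((1 / 2 : ℝ≥0) : ℝ) * dist y z := by
    intro y z
    refine (BoundedContinuousFunction.dist_le (by positivity)).2 fun t => ?_
    have hΦ : Φ y t - Φ z t =
        Real.exp (-(L * t)) • ∫ r in (0 : ℝ)..t, (F y r - F z r) := by
      rw [intervalIntegral.integral_sub (hF y _ _) (hF z _ _)]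
      simp only [Φ, I, BoundedContinuousFunction.coe_ofNormedAddCommGroup, ← smul_sub,
        add_sub_add_left_eq_sub]
    have hint : ‖∫ r in (0 : ℝ)..t, (F y r - F z r)‖ ≤
        ∫ r in (0 : ℝ)..t, K * dist y z * Real.exp (L * r) := by
      refine intervalIntegral.norm_integral_le_of_norm_le t.coe_nonneg
        (Eventually.of_forall fun r hr => ?_) (Continuous.intervalIntegrable (by fun_prop) _ _)
      refine ((hg _).norm_sub_le _ _).trans ?_
      rw [mul_assoc]
      refine mul_le_mul_of_nonneg_left ?_ K.coe_nonneg
      simp only [X, ← smul_sub]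
      rw [norm_smul, Real.norm_eq_abs, abs_of_pos (Real.exp_pos _), Real.coe_toNNReal r hr.1.le,
        mul_comm, ← dist_eq_norm]
      exact mul_le_mul_of_nonneg_right (BoundedContinuousFunction.dist_coe_le_dist _)
        (Real.exp_nonneg _)
    rw [intervalIntegral.integral_const_mul, hexpint] at hint
    rw [dist_eq_norm, hΦ, norm_smul, Real.norm_eq_abs, abs_of_pos (Real.exp_pos _), Real.exp_neg,
      ← div_eq_inv_mul, div_le_iff₀ (Real.exp_pos _)]
    refine hint.trans ?_
    have hK : (K : ℝ) / L ≤ 1 / 2 := by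
      rw [div_le_iff₀ hLpos, hL]
      linarith
    calc K * dist y z * ((Real.exp (L * t) - 1) / L)
        = K / L * (dist y z * (Real.exp (L * t) - 1)) := by ring
      _ ≤ 1 / 2 * (dist y z * (Real.exp (L * t) - 1)) := by
          refine mul_le_mul_of_nonneg_right hK (mul_nonneg dist_nonneg ?_)
          linarith [Real.one_le_exp (mul_nonneg hLpos.le t.coe_nonneg)]
      _ ≤ ((1 / 2 : ℝ≥0) : ℝ) * dist y z * Real.exp (L * t) := by
          push_cast
          nlinarith [dist_nonneg (x := y) (y := z)]
  have hcontr : ContractingWith (1 / 2) Φ :=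
    ⟨by rw [← NNReal.coe_lt_coe]; push_cast; norm_num, LipschitzWith.of_dist_le_mul hdist⟩
  obtain ⟨y, hy⟩ : ∃ y, Φ y = y := ⟨_, hcontr.fixedPoint_isFixedPt⟩
  refine ⟨X y, hX y, fun t => hF y _ _, fun t => ?_⟩
  have h : Real.exp (L * t) • Φ y t = I y t := by
    simp only [Φ, BoundedContinuousFunction.coe_ofNormedAddCommGroup]
    rw [smul_smul, ← Real.exp_add, add_neg_cancel, Real.exp_zero, one_smul]
  rw [hy] at h
  exact h

/-! ### Global solutions under an a priori bound -/

/-- The cutoff that is `1` on the ball of radius `R` and `0` outside the ball of radius `R + 1`. -/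
noncomputable def cutoff (R : ℝ) (y : EuclideanSpace ℝ (Fin n)) : ℝ := max 0 (min 1 (R + 1 - ‖y‖))

theorem cutoff_nonneg (R : ℝ) (y : EuclideanSpace ℝ (Fin n)) : 0 ≤ cutoff R y := le_max_left _ _

theorem cutoff_le_one (R : ℝ) (y : EuclideanSpace ℝ (Fin n)) : cutoff R y ≤ 1 :=
  max_le zero_le_one (min_le_left _ _)

theorem cutoff_eq_one {R : ℝ} {y : EuclideanSpace ℝ (Fin n)} (hy : ‖y‖ ≤ R) : cutoff R y = 1 := by
  rw [cutoff, min_eq_left (by linarith), max_eq_right zero_le_one]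

theorem cutoff_eq_zero {R : ℝ} {y : EuclideanSpace ℝ (Fin n)} (hy : R + 1 ≤ ‖y‖) :
    cutoff R y = 0 := by
  rw [cutoff, max_eq_left]
  exact (min_le_right _ _).trans (by linarith)

theorem abs_cutoff_sub_le (R : ℝ) (y z : EuclideanSpace ℝ (Fin n)) :
    |cutoff R y - cutoff R z| ≤ ‖y - z‖ := by
  have h1 : |cutoff R y - cutoff R z| ≤ |min 1 (R + 1 - ‖y‖) - min 1 (R + 1 - ‖z‖)| := by
    have := abs_max_sub_max_le_max 0 (min 1 (R + 1 - ‖y‖)) 0 (min 1 (R + 1 - ‖z‖))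
    simpa [cutoff] using this
  have h2 : |min 1 (R + 1 - ‖y‖) - min 1 (R + 1 - ‖z‖)| ≤ |(R + 1 - ‖y‖) - (R + 1 - ‖z‖)| := by
    have := abs_min_sub_min_le_max 1 (R + 1 - ‖y‖) 1 (R + 1 - ‖z‖)
    simpa using this
  refine h1.trans (h2.trans ?_)
  rw [sub_sub_sub_cancel_left, abs_sub_comm]
  exact abs_norm_sub_norm_le y z

theorem lipschitzWith_cutoff_smul {h : EuclideanSpace ℝ (Fin n) → EuclideanSpace ℝ (Fin n)}
    {R : ℝ} {K B : ℝ≥0} (hK : LipschitzOnWith K h (Metric.closedBall 0 (R + 1)))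
    (hB : ∀ y ∈ Metric.closedBall (0 : EuclideanSpace ℝ (Fin n)) (R + 1), ‖h y‖ ≤ B) :
    LipschitzWith (K + B) fun y => cutoff R y • h y := by
  -- It suffices to move from a point `y` of the ball; the other endpoint `z` may lie outside.
  have key : ∀ y z, ‖y‖ ≤ R + 1 →
      ‖cutoff R y • h y - cutoff R z • h z‖ ≤ (K + B) * ‖y - z‖ := by
    intro y z hy
    have hy' := mem_closedBall_zero_iff.2 hy
    have h1 : ‖(cutoff R y - cutoff R z) • h y‖ ≤ B * ‖y - z‖ := by
      rw [norm_smul, Real.norm_eq_abs, mul_comm]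
      exact mul_le_mul (hB y hy') (abs_cutoff_sub_le R y z) (abs_nonneg _) B.coe_nonneg
    have h2 : ‖cutoff R z • (h y - h z)‖ ≤ K * ‖y - z‖ := by
      rw [norm_smul, Real.norm_eq_abs, abs_of_nonneg (cutoff_nonneg R z)]
      rcases le_total ‖z‖ (R + 1) with hz | hz
      · exact (mul_le_of_le_one_left (norm_nonneg _) (cutoff_le_one R z)).trans
          (hK.norm_sub_le hy' (mem_closedBall_zero_iff.2 hz))
      · rw [cutoff_eq_zero hz, zero_mul]
        positivity
    have hsplit : cutoff R y • h y - cutoff R z • h z =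
        (cutoff R y - cutoff R z) • h y + cutoff R z • (h y - h z) := by
      rw [sub_smul, smul_sub]
      abel
    rw [hsplit]
    exact (norm_add_le _ _).trans (by linarith)
  refine LipschitzWith.of_dist_le_mul fun y z => ?_
  rw [dist_eq_norm, dist_eq_norm, NNReal.coe_add]
  rcases le_total ‖y‖ (R + 1) with hy | hy
  · exact key y z hy
  rcases le_total ‖z‖ (R + 1) with hz | hz
  · rw [norm_sub_rev, norm_sub_rev y z]
    exact key z y hz
  · rw [cutoff_eq_zero hy, cutoff_eq_zero hz, zero_smul, zero_smul, sub_zero, norm_zero]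
    positivity

variable {f : Fin N → EuclideanSpace ℝ (Fin n) → EuclideanSpace ℝ (Fin n)}

/-- If the trajectories from `x₀`, as long as they follow the system, have norm less than `R`, then
the solution of the field cut off at radius `R` never leaves the ball of radius `R`: up to the first
time at which its norm would reach `R` it follows the original system. Thus it solves that system
globally. -/
theorem exists_isSolution_of_apriori (hs : IsCadlag s) (hf : ∀ p, LocallyLipschitz (f p))
    (x₀ : EuclideanSpace ℝ (Fin n)) (R : ℝ)
    (hR : ∀ x : ℝ → EuclideanSpace ℝ (Fin n), ∀ τ, 0 ≤ τ → x 0 = x₀ → Continuous x →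
      (∀ t ∈ Set.Ico 0 τ, HasDerivWithinAt x (f (s t.toNNReal) (x t)) (Set.Ici t) t) →
      ‖x τ‖ < R) :
    ∃ x, IsSolution f s x₀ x := by
  obtain ⟨K, hK⟩ := exists_lipschitzOnWith_closedBall hf (R + 1)
  have hbd : ∀ p, ∃ B : ℝ, ∀ y ∈ Metric.closedBall (0 : EuclideanSpace ℝ (Fin n)) (R + 1),
      ‖f p y‖ ≤ B := fun p =>
    (isCompact_closedBall 0 (R + 1)).exists_bound_of_continuousOn (hf p).continuous.continuousOn
  choose B' hB' using hbd
  let B : ℝ≥0 := ∑ p, (B' p).toNNReal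
  have hB : ∀ p, ∀ y ∈ Metric.closedBall (0 : EuclideanSpace ℝ (Fin n)) (R + 1), ‖f p y‖ ≤ B := by
    intro p y hy
    refine (hB' p y hy).trans ((Real.le_coe_toNNReal _).trans ?_)
    exact NNReal.coe_le_coe.2 (Finset.single_le_sum (f := fun p => (B' p).toNNReal)
      (fun _ _ => zero_le) (Finset.mem_univ p))
  let g : Fin N → EuclideanSpace ℝ (Fin n) → EuclideanSpace ℝ (Fin n) :=
    fun p y => cutoff R y • f p y
  have hgL : ∀ p, LipschitzWith (K + B) (g p) := fun p => lipschitzWith_cutoff_smul (hK p) (hB p)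
  have hgB : ∀ p y, ‖g p y‖ ≤ B := by
    intro p y
    rw [norm_smul, Real.norm_eq_abs, abs_of_nonneg (cutoff_nonneg R y)]
    rcases le_total ‖y‖ (R + 1) with hy | hy
    · exact (mul_le_of_le_one_left (norm_nonneg _) (cutoff_le_one R y)).trans
        (hB p y (mem_closedBall_zero_iff.2 hy))
    · rw [cutoff_eq_zero hy, zero_mul]
      exact B.coe_nonneg
  have hgf : ∀ p y, ‖y‖ ≤ R → g p y = f p y := fun p y hy => by
    simp only [g, cutoff_eq_one hy, one_smul]
  obtain ⟨x, hx⟩ := exists_isSolution_of_lipschitzWith hs hgL hgB x₀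
  have hxc := hx.continuous_toNNReal
  have hbefore : ∀ τ : ℝ, 0 ≤ τ → (∀ t ∈ Set.Ico 0 τ, ‖x t.toNNReal‖ ≤ R) →
      ‖x τ.toNNReal‖ < R := by
    intro τ hτ hle
    refine hR (fun r => x r.toNNReal) τ hτ (by simpa using hx.apply_zero) hxc fun t ht => ?_
    have h := hx.hasDerivWithinAt (fun p => (hgL p).continuous) hs ht.1
    rwa [hgf _ _ (hle t ht)] at h
  have hin : ∀ t : ℝ, 0 ≤ t → ‖x t.toNNReal‖ < R := by
    by_contra! hcon
    -- The first time at which the norm reaches `R`.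
    let A : Set ℝ := {t | 0 ≤ t ∧ R ≤ ‖x t.toNNReal‖}
    have hAne : A.Nonempty := hcon
    have hAbdd : BddBelow A := ⟨0, fun t ht => ht.1⟩
    have hAcl : IsClosed A :=
      (isClosed_le continuous_const continuous_id).inter
        (isClosed_le continuous_const hxc.norm)
    have hmem : sInf A ∈ A := hAcl.csInf_mem hAne hAbdd
    refine absurd hmem.2 (not_le.2 (hbefore _ hmem.1 fun t ht => ?_))
    by_contra! h
    exact absurd (csInf_le hAbdd ⟨ht.1, h.le⟩) (not_le.2 ht.2)
  have heq : (fun r : ℝ => g (s r.toNNReal) (x r.toNNReal)) =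
      fun r : ℝ => f (s r.toNNReal) (x r.toNNReal) := by
    funext r
    refine hgf _ _ ?_
    have h := hin r.toNNReal r.toNNReal.coe_nonneg
    rw [Real.toNNReal_coe] at h
    exact h.le
  exact ⟨x, hx.continuous, fun t => heq ▸ hx.integrable t, fun t => heq ▸ hx.integral_eq t⟩

end Existence

/-! ### Stability of a single realization and of the random system -/

theorem iSup_enorm_lt_ofReal {ι : Sort*} {E : Type*} [NormedAddCommGroup E] {y : ι → E} {ε : ℝ}
    (hε : 0 < ε) (h : ∀ i, ‖y i‖ ≤ ε / 2) : (⨆ i, ‖y i‖ₑ) < ENNReal.ofReal ε := by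
  refine lt_of_le_of_lt (iSup_le fun i => ?_)
    ((ENNReal.ofReal_lt_ofReal_iff hε).2 (half_lt_self hε))
  rw [← ofReal_norm]
  exact ENNReal.ofReal_le_ofReal (h i)

/-- The a priori estimate `α₁ ‖x(T)‖ ≤ g(T)⁺ α₂ ‖x(0)‖` for all trajectories of the switched system
with mode signal `s` on intervals `[0, T]`. Trajectories that live on `[0, T]` only are included, as
the estimate serves to prove that solutions are global. -/
def HasGain {n N : ℕ} (f : Fin N → EuclideanSpace ℝ (Fin n) → EuclideanSpace ℝ (Fin n))
    (s : ℝ≥0 → Fin N) (α₁ α₂ : ℝ≥0 → ℝ≥0) (g : ℝ → ℝ) : Prop :=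
  ∀ T, 0 ≤ T → ∀ x : ℝ → EuclideanSpace ℝ (Fin n), ContinuousOn x (Set.Icc 0 T) →
    (∀ t ∈ Set.Ico 0 T, HasDerivWithinAt x (f (s t.toNNReal) (x t)) (Set.Ici t) t) →
    (α₁ ‖x T‖₊ : ℝ) ≤ max (g T) 0 * α₂ ‖x 0‖₊

theorem HasGain.le_of_isSolution {n N : ℕ}
    {f : Fin N → EuclideanSpace ℝ (Fin n) → EuclideanSpace ℝ (Fin n)} {s : ℝ≥0 → Fin N}
    {α₁ α₂ : ℝ≥0 → ℝ≥0} {g : ℝ → ℝ} (hg : HasGain f s α₁ α₂ g) (hf : ∀ p, Continuous (f p))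
    (hs : IsCadlag s) {x₀ : EuclideanSpace ℝ (Fin n)} {x : ℝ≥0 → EuclideanSpace ℝ (Fin n)}
    (hx : IsSolution f s x₀ x) (t : ℝ≥0) : (α₁ ‖x t‖₊ : ℝ) ≤ max (g t) 0 * α₂ ‖x₀‖₊ := by
  have h := hg t t.coe_nonneg (fun r => x r.toNNReal) hx.continuous_toNNReal.continuousOn
    fun r hr => hx.hasDerivWithinAt hf hs hr.1
  simpa [hx.apply_zero] using h

end SwitchedSystem

theorem mainTheorem3 {Ω : Type*} [MeasurableSpace Ω] (ℙ : Measure Ω) [IsProbabilityMeasure ℙ]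
    (n N : ℕ) [NeZero N]
    (f : Fin N → EuclideanSpace ℝ (Fin n) → EuclideanSpace ℝ (Fin n))
    (hf : ∀ p, LocallyLipschitz (f p)) (hf0 : ∀ p, f p 0 = 0)
    (σ : ℝ≥0 → Ω → Fin N) (π₀ : Fin N → ℝ) (Q : Matrix (Fin N) (Fin N) ℝ)
    (hσ : IsMarkovChain ℙ σ π₀ Q)
    (V : Fin N → EuclideanSpace ℝ (Fin n) → ℝ) (hV : ∀ p, ContDiff ℝ 1 (V p))
    (α₁ α₂ : ℝ≥0 → ℝ≥0) (hα₁ : IsClassKInfty α₁) (hα₂ : IsClassKInfty α₂)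
    (l₀ μ : ℝ) (hl₀ : 0 < l₀) (hμ : 1 < μ)
    (hbound : ∀ p x, (α₁ ‖x‖₊ : ℝ) ≤ V p x ∧ V p x ≤ (α₂ ‖x‖₊ : ℝ))
    (hdecay : ∀ p x, fderiv ℝ (V p) x (f p x) ≤ -l₀ * V p x)
    (hratio : ∀ p₁ p₂ x, V p₁ x ≤ μ * V p₂ x)
    (hrate : qBar Q ≠ 0 → μ < (l₀ + qTilde Q) / qBar Q) :
    (∀ᵐ ω ∂ℙ, ∀ x₀, ∃! x, IsSolution f (fun t => σ t ω) x₀ x) ∧ GASAlmostSurely ℙ f σ := by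
  have hVdiff : ∀ p, Differentiable ℝ (V p) := fun p => (hV p).differentiable one_ne_zero
  have hV0 : ∀ p y, 0 ≤ V p y := fun p y => (α₁ ‖y‖₊).coe_nonneg.trans (hbound p y).1
  have hfc : ∀ p, Continuous (f p) := fun p => (hf p).continuous
  -- Almost every path is càdlàg and has a bounded gain `g` that tends to zero.
  have hgain : ∀ᵐ ω ∂ℙ, IsCadlag (fun t => σ t ω) ∧ ∃ g : ℝ → ℝ, Tendsto g atTop (𝓝 0) ∧
      (∃ C, ∀ T, g T ≤ C) ∧ HasGain f (fun t => σ t ω) α₁ α₂ g := by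
    filter_upwards [hσ.cadlag, ae_exists_gridWeight_bound hσ hμ.le hl₀
      (fun i => Finset.le_sup' (fun i => |Q i i|) (Finset.mem_univ i))
      (jump_rate_lt hσ.generator hl₀ hrate)] with ω hs ⟨a, ha, hfreq⟩
    obtain ⟨g, hg, hC, hle⟩ := exists_gain hVdiff hV0 hμ.le hratio hs hl₀.le ha hfreq
    refine ⟨hs, g, hg, hC, fun T hT x hx hx' => ?_⟩
    calc (α₁ ‖x T‖₊ : ℝ) ≤ V (σ T.toNNReal ω) (x T) := (hbound _ _).1
      _ ≤ g T * V (σ 0 ω) (x 0) := hle T hT x _ ⟨hx, hx', fun t _ => hdecay _ _⟩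
      _ ≤ max (g T) 0 * V (σ 0 ω) (x 0) :=
          mul_le_mul_of_nonneg_right (le_max_left _ _) (hV0 _ _)
      _ ≤ max (g T) 0 * α₂ ‖x 0‖₊ :=
          mul_le_mul_of_nonneg_left (hbound _ _).2 (le_max_right _ _)
  have hsmall : ∀ {ε : ℝ} {y : EuclideanSpace ℝ (Fin n)}, 0 < ε →
      (α₁ ‖y‖₊ : ℝ) < α₁ (ε / 2).toNNReal → ‖y‖ ≤ ε / 2 := by
    intro ε y hε hy
    have h := hα₁.strictMono.lt_iff_lt.1 (NNReal.coe_lt_coe.1 hy)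
    have h' := NNReal.coe_lt_coe.2 h
    rw [Real.coe_toNNReal _ (half_pos hε).le, coe_nnnorm] at h'
    exact h'.le
  have hαpos : ∀ {ε : ℝ}, 0 < ε → (0 : ℝ) < α₁ (ε / 2).toNNReal := by
    intro ε hε
    have h := hα₁.strictMono (Real.toNNReal_pos.2 (half_pos hε))
    rw [hα₁.map_zero] at h
    exact_mod_cast h
  refine ⟨?_, ?_, ?_⟩
  · filter_upwards [hgain] with ω ⟨hs, g, _, ⟨C, hC⟩, hle⟩ x₀
    -- `α₁` is unbounded, so the a priori bound confines all trajectories to a ball.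
    obtain ⟨R, hR⟩ := (hα₁.tendsto_atTop.eventually
      (eventually_gt_atTop ((max C 0 * α₂ ‖x₀‖₊).toNNReal))).exists
    obtain ⟨x, hx⟩ := exists_isSolution_of_apriori hs hf x₀ R fun x τ hτ hx0 hxc hx' => by
      by_contra! hcon
      have h1 := hle τ hτ x hxc.continuousOn hx'
      have h2 : (α₁ R : ℝ) ≤ α₁ ‖x τ‖₊ :=
        NNReal.coe_le_coe.2 (hα₁.strictMono.monotone (by exact_mod_cast hcon))
      have h3 : max (g τ) 0 * (α₂ ‖x 0‖₊ : ℝ) ≤ max C 0 * α₂ ‖x 0‖₊ :=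
        mul_le_mul_of_nonneg_right (max_le_max_right 0 (hC τ)) (NNReal.coe_nonneg _)
      have h4 := (Real.toNNReal_lt_iff_lt_coe
        (mul_nonneg (le_max_right C 0) (NNReal.coe_nonneg _))).1 hR
      rw [hx0] at h1 h3
      linarith
    exact ⟨x, hx, fun y hy => hy.unique hf hs hx⟩
  · filter_upwards [hgain] with ω ⟨hs, g, _, ⟨C, hC⟩, hle⟩ ε hε
    have hlim : Tendsto (fun r : ℝ≥0 => max C 0 * (α₂ r : ℝ)) (𝓝 0) (𝓝 0) := by
      have h : Continuous fun r : ℝ≥0 => max C 0 * (α₂ r : ℝ) :=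
        continuous_const.mul (NNReal.continuous_coe.comp hα₂.continuous)
      simpa [hα₂.map_zero] using h.tendsto 0
    obtain ⟨δ, hδ, hball⟩ := Metric.eventually_nhds_iff.1
      (hlim.eventually (gt_mem_nhds (hαpos hε)))
    refine ⟨δ, hδ, fun x₀ x hx hx₀ => iSup_enorm_lt_ofReal hε fun t => hsmall hε ?_⟩
    have h1 := hle.le_of_isSolution hfc hs hx t
    have h2 : max (g t) 0 * (α₂ ‖x₀‖₊ : ℝ) ≤ max C 0 * α₂ ‖x₀‖₊ :=
      mul_le_mul_of_nonneg_right (max_le_max_right 0 (hC t)) (NNReal.coe_nonneg _)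
    exact h1.trans_lt (h2.trans_lt (hball (by simpa [NNReal.dist_eq] using hx₀)))
  · filter_upwards [hgain] with ω ⟨hs, g, hg, _, hle⟩ r ε hr hε
    have hlim : Tendsto (fun t => max (g t) 0 * (α₂ r.toNNReal : ℝ)) atTop (𝓝 0) := by
      simpa using (hg.max (tendsto_const_nhds (x := (0 : ℝ)))).mul_const (α₂ r.toNNReal : ℝ)
    obtain ⟨T, hT⟩ := eventually_atTop.1 (hlim.eventually (gt_mem_nhds (hαpos hε)))
    refine ⟨T.toNNReal, fun x₀ x hx hx₀ => ?_⟩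
    rw [iSup_subtype']
    refine iSup_enorm_lt_ofReal (y := fun t : {t : ℝ≥0 // T.toNNReal ≤ t} => x t) hε
      fun t => hsmall hε ?_
    have h1 := hle.le_of_isSolution hfc hs hx t
    have h2 : max (g t) 0 * (α₂ ‖x₀‖₊ : ℝ) ≤ max (g t) 0 * α₂ r.toNNReal := by
      refine mul_le_mul_of_nonneg_left (NNReal.coe_le_coe.2 ?_) (le_max_right _ _)
      refine hα₂.strictMono.monotone ?_
      rw [← norm_toNNReal]
      exact Real.toNNReal_le_toNNReal hx₀.le
    exact h1.trans_lt (h2.trans_lt (hT t (Real.toNNReal_le_iff_le_coe.1 t.2)))
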